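/- Let $p$ be an odd prime and let $s(p)$ be the smallest positive integer $s$ with $p \mid 2^s-1$. Let $C \subseteq \mathbb{F}_2^n$ be a self-dual binary linear code of length $n$ (that is, $C = C^\perp$ with respect to the standard bilinear form), and let $g \in \operatorname{Aut}(C)$ be an automorphism of $C$ (a permutation of the $n$ coordinates mapping $C$ onto itself) of order $2p$ such that the involution $g^p$ has no fixed points on the $n$ coordinates. Suppose that $n \equiv 0 \bmod 4$ and that $s(p)$ is even. If $g$ has an odd number of $2$-cycles in its action on the coordinates, then $C$ is not projective as an $\mathbb{F}_2\langle g\rangle$-module. -/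

import Mathlib

/-- The dual of a binary linear code of length `n` with respect to the standard bilinear form. -/
def dualCode {n : ℕ} (C : Submodule (ZMod 2) (Fin n → ZMod 2)) :
    Submodule (ZMod 2) (Fin n → ZMod 2) :=
  C.orthogonalBilin (dotProductBilin (ZMod 2) (ZMod 2))

/-- A code is self-dual if it equals its dual. -/
def IsSelfDualCode {n : ℕ} (C : Submodule (ZMod 2) (Fin n → ZMod 2)) : Prop :=
  C = dualCode C

/-- The action of the symmetric group on words by permuting the coordinates:
the entry of `c` at position `i` is moved to position `σ i`. -/
def permRep (n : ℕ) : Representation (ZMod 2) (Equiv.Perm (Fin n)) (Fin n → ZMod 2) where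
  toFun σ :=
    { toFun := fun c i => c (σ⁻¹ i)
      map_add' := fun _ _ => rfl
      map_smul' := fun _ _ => rfl }
  map_one' := rfl
  map_mul' _ _ := rfl

/-- The automorphism group of a code: the coordinate permutations that map the code onto
itself. -/
def codeAut {n : ℕ} (C : Submodule (ZMod 2) (Fin n → ZMod 2)) :
    Subgroup (Equiv.Perm (Fin n)) where
  carrier := {σ | C.map (permRep n σ) = C}
  mul_mem' := by
    intro a b ha hb
    change C.map (permRep n (a * b)) = C
    rw [map_mul, Module.End.mul_eq_comp, Submodule.map_comp, hb, ha]
  one_mem' := by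
    change C.map (permRep n 1) = C
    rw [map_one]
    exact Submodule.map_id C
  inv_mem' := by
    intro a ha
    change C.map (permRep n a⁻¹) = C
    have ha' : C.map (permRep n a) = C := ha
    conv_lhs => rw [← ha']
    rw [← Submodule.map_comp, ← Module.End.mul_eq_comp, ← map_mul, inv_mul_cancel, map_one]
    exact Submodule.map_id C

/-- The action of the automorphism group of a code on the code. -/
def codeRep {n : ℕ} (C : Submodule (ZMod 2) (Fin n → ZMod 2)) :
    Representation (ZMod 2) (codeAut C) C where
  toFun σ := (permRep n σ.1).restrict (fun c hc => by
    have h : C.map (permRep n σ.1) = C := σ.2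
    have h' := Submodule.mem_map_of_mem (f := permRep n σ.1) hc
    rwa [h] at h')
  map_one' := rfl
  map_mul' _ _ := rfl

/-- The action on the code `C` of the cyclic group generated by an automorphism `g` of `C`. -/
def cyclicCodeRep {n : ℕ} (C : Submodule (ZMod 2) (Fin n → ZMod 2)) (g : codeAut C) :
    Representation (ZMod 2) (Subgroup.zpowers g) C :=
  (codeRep C).comp (Subgroup.zpowers g).subtype

/-- `C` is projective as a module over the group algebra of the cyclic group generated by `g`.
As this group is commutative, left and right modules agree. -/
def IsProjectiveCode {n : ℕ} (C : Submodule (ZMod 2) (Fin n → ZMod 2)) (g : codeAut C) : Prop :=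
  Module.Projective (MonoidAlgebra (ZMod 2) (Subgroup.zpowers g)) (cyclicCodeRep C g).asModule

/-- The smallest positive integer `s` such that `p` divides `2 ^ s - 1`. -/
noncomputable def sExp (p : ℕ) : ℕ :=
  sInf {s : ℕ | 0 < s ∧ p ∣ 2 ^ s - 1}

/-! Let `σ = g ^ 2`, of order `p`, and `τ = g ^ p`, and take an irreducible factor `q` of the `p`-th
cyclotomic polynomial over `𝔽₂`. As `s(p)` is even, `σ⁻¹ = σ ^ 2 ^ k` for some `k`, so the adjoint
of `q(σ)` is a power of it, and `U = ker q(σ)` and `W = range q(σ)` are orthogonal complements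
(`orthogonal_ker_aeval_funLeft`). Self-duality then gives `2 dim (C ⊓ U) = dim U = r deg q`, with
`r` the number of `p`-cycles of `σ` (`finrank_ker_aeval_funLeft`). If `C` were projective, `1 + τ`
would have equal kernel and image on `C`, hence on `C ⊓ U`, so `dim (C ⊓ U)` would be twice the
dimension of a space over `𝔽₂[X] / (q)`. Thus `4 ∣ r`, and `n = p r + 2 w` with `4 ∣ n` makes the
number `w` of `2`-cycles even. -/

/-! ### Polynomials in a permutation and linear recurrences. -/

open Polynomial in
/-- A space killed by `q(S)`, with `q` irreducible, is a vector space over `K[X] / (q)`. -/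
theorem natDegree_dvd_finrank_of_aeval_eq_zero {K W : Type*} [Field K] [AddCommGroup W]
    [Module K W] {q : K[X]} (hq : Irreducible q) (S : Module.End K W) (hS : aeval S q = 0) :
    q.natDegree ∣ Module.finrank K W := by
  have : Fact (Irreducible q) := ⟨hq⟩
  let φ : AdjoinRoot q →ₐ[K] Module.End K W :=
    Ideal.Quotient.liftₐ (Ideal.span {q}) (aeval S) fun a ha => by
      obtain ⟨b, rfl⟩ := Ideal.mem_span_singleton.1 ha
      rw [map_mul, hS, zero_mul]
  let : Module (AdjoinRoot q) W := Module.compHom W φ.toRingHom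
  have : IsScalarTower K (AdjoinRoot q) W := ⟨fun a b w => by
    change φ (a • b) w = a • φ b w
    rw [map_smul]; rfl⟩
  have h := Module.finrank_mul_finrank K (AdjoinRoot q) W
  rw [(AdjoinRoot.powerBasis hq.ne_zero).finrank, AdjoinRoot.powerBasis_dim] at h
  exact ⟨_, h.symm⟩

open Polynomial in
theorem aeval_funLeft_apply {K α : Type*} [CommRing K] (f : α → α) (q : K[X]) (c : α → K) (i : α) :
    aeval (LinearMap.funLeft K K f) q c i =
      ∑ j ∈ Finset.range (q.natDegree + 1), q.coeff j * c (f^[j] i) := by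
  have h (j : ℕ) : ((LinearMap.funLeft K K f) ^ j) c = fun i => c (f^[j] i) := by
    induction j with
    | zero => rfl
    | succ j ih => rw [pow_succ', Module.End.mul_apply, ih]; rfl
  rw [aeval_eq_sum_range, LinearMap.sum_apply, Finset.sum_apply]
  exact Finset.sum_congr rfl fun j _ => by
    rw [LinearMap.smul_apply, h]; rfl

open Polynomial in
/-- The linear recurrence whose characteristic polynomial is the monic polynomial `q`. -/
def Polynomial.linearRecurrence {K : Type*} [CommRing K] (q : K[X]) : LinearRecurrence K :=
  ⟨q.natDegree, fun i => - q.coeff i⟩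

open Polynomial in
theorem mem_solSpace_linearRecurrence {K : Type*} [CommRing K] {q : K[X]} (hq : q.Monic)
    (u : ℕ → K) : u ∈ q.linearRecurrence.solSpace ↔
      aeval (LinearMap.funLeft K K Nat.succ) q u = 0 := by
  have h (m : ℕ) : aeval (LinearMap.funLeft K K Nat.succ) q u m =
      u (m + q.natDegree) - ∑ i : Fin q.natDegree, - q.coeff i * u (m + i) := by
    have h' (j : ℕ) : Nat.succ^[j] m = m + j := by
      induction j with
      | zero => rfl
      | succ j ih => rw [Function.iterate_succ_apply', ih]; rfl
    rw [aeval_funLeft_apply, Finset.sum_range_succ, hq.coeff_natDegree, Finset.sum_range]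
    simp only [h', neg_mul, Finset.sum_neg_distrib]
    ring
  rw [← LinearRecurrence.is_sol_iff_mem_solSpace, funext_iff]
  refine forall_congr' fun m => ?_
  rw [h, Pi.zero_apply, sub_eq_zero]
  rfl

open Polynomial in
theorem finrank_solSpace_linearRecurrence {K : Type*} [Field K] (q : K[X]) :
    Module.finrank K q.linearRecurrence.solSpace = q.natDegree := by
  rw [q.linearRecurrence.toInit.finrank_eq, Module.finrank_fin_fun]
  rfl

-- Periodicity is what allows a solution to be wrapped around a `p`-cycle.
open Polynomial in
theorem periodic_of_mem_solSpace {K : Type*} [Field K] {q : K[X]} (hq : q.Monic) {p : ℕ}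
    (hqp : q ∣ X ^ p - 1) {u : ℕ → K} (hu : u ∈ q.linearRecurrence.solSpace) :
    Function.Periodic u p := by
  rw [mem_solSpace_linearRecurrence hq] at hu
  obtain ⟨h, hh⟩ := hqp
  have h1 : aeval (LinearMap.funLeft K K Nat.succ) (X ^ p - 1 : K[X]) u = 0 := by
    rw [hh, mul_comm, map_mul, Module.End.mul_apply, hu, map_zero]
  have h2 (j m : ℕ) : ((LinearMap.funLeft K K Nat.succ) ^ j) u m = u (m + j) := by
    induction j generalizing m with
    | zero => rfl
    | succ j ih =>
      rw [pow_succ', Module.End.mul_apply, LinearMap.funLeft_apply, ih, Nat.succ_add]; rfl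
  intro m
  have h3 := congrFun h1 m
  rw [map_sub, map_pow, aeval_X, map_one, LinearMap.sub_apply, Pi.sub_apply, h2] at h3
  exact sub_eq_zero.1 h3

open Polynomial in
/-- The kernel of `q(σ)` on functions is a sum of solution spaces, one for each `p`-cycle. -/
theorem finrank_ker_aeval_funLeft {K α : Type*} [Field K] [Fintype α] [DecidableEq α]
    {q : K[X]} (hq : q.Monic) {p : ℕ} (hp : p.Prime) (hqp : q ∣ X ^ p - 1) (hq1 : q.eval 1 ≠ 0)
    (σ : Equiv.Perm α) (hσ : orderOf σ = p) :
    Module.finrank K (LinearMap.ker (aeval (LinearMap.funLeft K K σ) q)) =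
      q.natDegree * σ.cycleFactorsFinset.card := by
  classical
  have hrep : ∀ c : σ.cycleFactorsFinset, ∃ x, x ∈ σ.support ∧ σ.cycleOf x = c := by
    rintro ⟨c, hc⟩
    obtain ⟨x, hx⟩ := (Equiv.Perm.mem_cycleFactorsFinset_iff.1 hc).1.nonempty_support
    exact ⟨x, Equiv.Perm.mem_cycleFactorsFinset_support_le hc hx,
      (Equiv.Perm.cycle_is_cycleOf hx hc).symm⟩
  choose rep hrep1 hrep2 using hrep
  have horb (i : α) (hi : i ∈ σ.support) : ∃ j, (σ ^ j)
      (rep ⟨σ.cycleOf i, Equiv.Perm.cycleOf_mem_cycleFactorsFinset_iff.2 hi⟩) = i := by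
    have := hrep2 ⟨σ.cycleOf i, Equiv.Perm.cycleOf_mem_cycleFactorsFinset_iff.2 hi⟩
    obtain ⟨j, -, hj⟩ := (Equiv.Perm.sameCycle_iff_cycleOf_eq_of_mem_support
      (hrep1 _) hi |>.2 this).exists_pow_eq'
    exact ⟨j, hj⟩
  choose idx hidx using horb
  -- If `p ∤ d`, then `σ` is a power of `σ ^ d`, so a point fixed by `σ ^ d` is fixed by `σ`.
  have hper (x : α) (hx : x ∈ σ.support) (a b : ℕ) (h : (σ ^ a) x = (σ ^ b) x) : a ≡ b [MOD p] := by
    wlog hab : a ≤ b generalizing a b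
    · exact (this b a h.symm (le_of_not_ge hab)).symm
    obtain ⟨d, rfl⟩ := Nat.exists_eq_add_of_le hab
    rw [pow_add, Equiv.Perm.mul_apply] at h
    have h0 : (σ ^ d) x = x := ((σ ^ a).injective h).symm
    have hd : p ∣ d := by
      by_contra hd
      have hc : Nat.Coprime d p := ((Nat.Prime.coprime_iff_not_dvd hp).2 hd).symm
      have h1 : σ x = x := by
        have h2 : σ ∈ Subgroup.zpowers (σ ^ d) := by
          rw [mem_zpowers_pow_iff, hσ]
          exact hc
        obtain ⟨k, hk⟩ := Subgroup.mem_zpowers_iff.1 h2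
        rw [← hk]
        exact Function.IsFixedPt.perm_zpow h0 k
      exact (Equiv.Perm.mem_support.1 hx) h1
    exact (Nat.modEq_iff_dvd' hab).2 (by simpa using hd)
  have hsum (c : α → K) (hc : aeval (LinearMap.funLeft K K σ) q c = 0) (i : α) :
      ∑ j ∈ Finset.range (q.natDegree + 1), q.coeff j * c ((σ ^ j) i) = 0 := by
    have := congrFun hc i
    rw [aeval_funLeft_apply] at this
    simpa [← Equiv.Perm.iterate_eq_pow] using this
  have hsucc (j m : ℕ) : Nat.succ^[j] m = m + j := by
    induction j with
    | zero => rfl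
    | succ j ih => rw [Function.iterate_succ_apply', ih]; rfl
  -- `F` reads a function along each cycle, starting at its base point `rep r`.
  let F : LinearMap.ker (aeval (LinearMap.funLeft K K σ) q) →ₗ[K]
      (σ.cycleFactorsFinset → q.linearRecurrence.solSpace) :=
    { toFun := fun c r => ⟨fun j => c.1 ((σ ^ j) (rep r)), by
        rw [mem_solSpace_linearRecurrence hq]
        funext m
        rw [aeval_funLeft_apply, Pi.zero_apply, ← hsum c.1 c.2 ((σ ^ m) (rep r))]
        refine Finset.sum_congr rfl fun j _ => ?_
        rw [hsucc, ← Equiv.Perm.mul_apply, ← pow_add, add_comm]⟩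
      map_add' := fun _ _ => rfl
      map_smul' := fun _ _ => rfl }
  have hfix (i : α) (hi : i ∉ σ.support) (j : ℕ) : (σ ^ j) i = i :=
    (show Function.IsFixedPt σ i from Equiv.Perm.notMem_support.1 hi).perm_pow j
  have hinj : Function.Injective F := by
    rw [← LinearMap.ker_eq_bot, LinearMap.ker_eq_bot']
    intro c hc
    ext i
    by_cases hi : i ∈ σ.support
    · have h1 := congrFun (congrArg Subtype.val (congrFun hc
        ⟨σ.cycleOf i, Equiv.Perm.cycleOf_mem_cycleFactorsFinset_iff.2 hi⟩)) (idx i hi)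
      change c.1 ((σ ^ _) _) = 0 at h1
      rwa [hidx] at h1
    -- At a fixed point the relation reads `q(1) * c i = 0`.
    · have h1 := hsum c.1 c.2 i
      simp only [hfix i hi, ← Finset.sum_mul] at h1
      have h2 := q.eval_eq_sum_range 1
      simp only [one_pow, mul_one] at h2
      rw [← h2] at h1
      exact (mul_eq_zero.1 h1).resolve_left hq1
  have hsurj : Function.Surjective F := by
    intro u
    -- `idx` is only determined modulo `p`; `hper` and periodicity make its choice harmless.
    let c : α → K := fun i => if hi : i ∈ σ.support then
      (u ⟨σ.cycleOf i, Equiv.Perm.cycleOf_mem_cycleFactorsFinset_iff.2 hi⟩).1 (idx i hi) else 0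
    have hmem (r : σ.cycleFactorsFinset) (m : ℕ) : (σ ^ m) (rep r) ∈ σ.support :=
      Equiv.Perm.pow_apply_mem_support.2 (hrep1 r)
    have hcu (r : σ.cycleFactorsFinset) (m : ℕ) : c ((σ ^ m) (rep r)) = (u r).1 m := by
      have hr : (⟨σ.cycleOf ((σ ^ m) (rep r)),
          Equiv.Perm.cycleOf_mem_cycleFactorsFinset_iff.2 (hmem r m)⟩ : σ.cycleFactorsFinset) = r :=
        Subtype.ext ((Equiv.Perm.cycleOf_self_apply_pow σ m (rep r)).trans (hrep2 r))
      have h1 := hidx _ (hmem r m)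
      rw [hr] at h1
      change dite _ _ _ = _
      rw [dif_pos (hmem r m), hr]
      have h2 := hper _ (hrep1 r) _ _ h1
      have hP := periodic_of_mem_solSpace hq hqp (u r).2
      rw [← hP.map_mod_nat, h2, hP.map_mod_nat]
    refine ⟨⟨c, ?_⟩, funext fun r => Subtype.ext (funext fun m => hcu r m)⟩
    rw [LinearMap.mem_ker]
    funext i
    rw [aeval_funLeft_apply, Pi.zero_apply]
    by_cases hi : i ∈ σ.support
    · have h0 := hidx i hi
      set r : σ.cycleFactorsFinset :=
        ⟨σ.cycleOf i, Equiv.Perm.cycleOf_mem_cycleFactorsFinset_iff.2 hi⟩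
      have h1 := congrFun ((mem_solSpace_linearRecurrence hq _).1 (u r).2) (idx i hi)
      rw [aeval_funLeft_apply, Pi.zero_apply] at h1
      rw [← h1]
      refine Finset.sum_congr rfl fun j _ => ?_
      rw [hsucc, ← hcu, Equiv.Perm.iterate_eq_pow, add_comm, pow_add, Equiv.Perm.mul_apply, h0]
    · refine Finset.sum_eq_zero fun j _ => ?_
      rw [Equiv.Perm.iterate_eq_pow, hfix i hi]
      simp only [c, dif_neg hi, mul_zero]
  have : Module.Finite K q.linearRecurrence.solSpace :=
    Module.Finite.equiv q.linearRecurrence.toInit.symm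
  rw [(LinearEquiv.ofBijective F ⟨hinj, hsurj⟩).finrank_eq, Module.finrank_pi_fintype]
  simp [finrank_solSpace_linearRecurrence, mul_comm]

/-! ### Counting points by cycles. -/

/-- Points of the `2`-cycles, counted. -/
theorem card_filter_two_cycle {α : Type*} [Fintype α] [DecidableEq α] (g : Equiv.Perm α) :
    (Finset.univ.filter fun i => g i ≠ i ∧ (g ^ 2) i = i).card = 2 * g.cycleType.count 2 := by
  classical
  have h1 : (Finset.univ.filter fun i => g i ≠ i ∧ (g ^ 2) i = i) =
      (g.cycleFactorsFinset.filter fun c => c.support.card = 2).biUnion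
        (fun c => c.support) := by
    ext i
    simp only [Finset.mem_filter, Finset.mem_univ, true_and, Finset.mem_biUnion]
    constructor
    · rintro ⟨hi, hi2⟩
      have hi' : i ∈ g.support := Equiv.Perm.mem_support.2 hi
      refine ⟨g.cycleOf i, ⟨Equiv.Perm.cycleOf_mem_cycleFactorsFinset_iff.2 hi', ?_⟩,
        Equiv.Perm.mem_support_cycleOf_iff.2 ⟨.refl _ _, hi'⟩⟩
      have hc := (Equiv.Perm.isCycle_cycleOf g hi)
      rw [← hc.orderOf]
      refine orderOf_eq_prime ?_ ?_
      · rw [hc.pow_eq_one_iff]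
        refine ⟨i, by simpa using hi, ?_⟩
        rw [Equiv.Perm.cycleOf_pow_apply_self, hi2]
      · exact hc.ne_one
    · rintro ⟨c, ⟨hc, hc2⟩, hi⟩
      have hcy := (Equiv.Perm.mem_cycleFactorsFinset_iff.1 hc).1
      have hci := Equiv.Perm.cycle_is_cycleOf hi hc
      refine ⟨Equiv.Perm.mem_support.1 (Equiv.Perm.mem_cycleFactorsFinset_support_le hc hi), ?_⟩
      rw [← Equiv.Perm.cycleOf_pow_apply_self, ← hci, ← hc2, ← hcy.orderOf, pow_orderOf_eq_one]
      rfl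
  rw [h1, Finset.card_biUnion, Finset.sum_congr rfl (g := fun _ => 2)]
  · rw [Finset.sum_const, smul_eq_mul, mul_comm, Equiv.Perm.cycleType_def, Multiset.count_map]
    congr 1
    rw [Finset.card_def, Finset.filter_val]
    simp [eq_comm]
  · intro c hc
    exact (Finset.mem_filter.1 hc).2
  · intro c hc d hd hcd
    exact (Equiv.Perm.cycleFactorsFinset_pairwise_disjoint g (Finset.mem_filter.1 hc).1
      (Finset.mem_filter.1 hd).1 hcd).disjoint_support

/-- If `g ^ p` has no fixed point, the points lie in `p`-cycles of `g ^ 2` or `2`-cycles of `g`. -/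
theorem card_eq_of_free_involution {α : Type*} [Fintype α] [DecidableEq α] {p : ℕ} (hp : p.Prime)
    (g : Equiv.Perm α) (hg : orderOf (g ^ 2) = p) (hfree : ∀ i, (g ^ p) i ≠ i) :
    Fintype.card α = p * (g ^ 2).cycleFactorsFinset.card + 2 * g.cycleType.count 2 := by
  classical
  obtain ⟨m, hm⟩ := Equiv.Perm.cycleType_prime_order (σ := g ^ 2) (by rwa [hg])
  have h1 : (g ^ 2).support.card = p * (g ^ 2).cycleFactorsFinset.card := by
    have h2 : (g ^ 2).cycleFactorsFinset.card = Multiset.card (g ^ 2).cycleType := by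
      rw [Equiv.Perm.cycleType_def, Multiset.card_map]; rfl
    rw [h2, ← Equiv.Perm.sum_cycleType, hm, hg]
    rw [Multiset.sum_replicate, Multiset.card_replicate, smul_eq_mul, mul_comm]
  rw [← h1, ← card_filter_two_cycle, ← Finset.card_univ,
    ← Finset.card_filter_add_card_filter_not (s := Finset.univ) (fun i => i ∈ (g ^ 2).support)]
  congr 2
  · ext i; simp
  · ext i
    simp only [Finset.mem_filter, Finset.mem_univ, true_and, Equiv.Perm.mem_support, not_not]
    refine ⟨fun h => ⟨fun h' => hfree i ?_, h⟩, And.right⟩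
    exact Function.IsFixedPt.perm_pow h' p

/-! ### Arithmetic of `s(p)` and the factor `q`. -/

theorem exists_dvd_two_pow_add_one_of_even_sExp {p : ℕ} (hp : p.Prime) (hp_odd : Odd p)
    (hs : Even (sExp p)) : ∃ k, p ∣ 2 ^ k + 1 := by
  have hne : {s : ℕ | 0 < s ∧ p ∣ 2 ^ s - 1}.Nonempty := by
    refine ⟨p - 1, Nat.sub_pos_of_lt hp.one_lt, ?_⟩
    have hc : Nat.Coprime 2 p := (Nat.coprime_two_left).2 hp_odd
    have := Nat.ModEq.pow_totient hc
    rw [Nat.totient_prime hp] at this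
    exact (Nat.modEq_iff_dvd' Nat.one_le_two_pow).1 this.symm
  obtain ⟨h0, h1⟩ : 0 < sExp p ∧ p ∣ 2 ^ sExp p - 1 := Nat.sInf_mem hne
  obtain ⟨k, hk⟩ := hs
  have h2 : 2 ^ sExp p - 1 = (2 ^ k + 1) * (2 ^ k - 1) := by
    rw [← Nat.sq_sub_sq, one_pow, hk, pow_add, sq]
  rw [h2] at h1
  -- By minimality of `sExp p = k + k`, `p` cannot divide `2 ^ k - 1`.
  refine ⟨k, (hp.dvd_mul.1 h1).resolve_right fun h => ?_⟩
  have : sExp p ≤ k := Nat.sInf_le ⟨by lia, h⟩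
  lia

-- Frobenius: coefficients in `𝔽₂` give `q(X ^ 2) = q(X) ^ 2`.
open Polynomial in
theorem aeval_pow_two_pow {A : Type*} [Ring A] [Algebra (ZMod 2) A] (S : A) (q : (ZMod 2)[X])
    (k : ℕ) : aeval (S ^ 2 ^ k) q = aeval S q ^ 2 ^ k := by
  induction k with
  | zero => simp
  | succ k ih =>
    rw [pow_succ, pow_mul, pow_mul, ← ih, ← expand_aeval, ZMod.expand_card, map_pow]

-- Coprimality holds because `X ^ p - 1` is separable for odd `p`; and `q(1) ≠ 0` since the
-- cyclotomic polynomial takes the value `p = 1` there.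
open Polynomial in
theorem exists_irreducible_dvd_cyclotomic {p : ℕ} (hp : p.Prime) (hp_odd : Odd p) :
    ∃ q : (ZMod 2)[X], q.Monic ∧ Irreducible q ∧ q.eval 1 ≠ 0 ∧
      ∃ h, q * h = X ^ p - 1 ∧ IsCoprime q h := by
  have : Fact p.Prime := ⟨hp⟩
  have h2 : ((p : ℕ) : ZMod 2) = 1 := by
    rw [ZMod.natCast_eq_one_iff_odd]; exact hp_odd
  obtain ⟨q, hm, hi, hd⟩ := exists_monic_irreducible_factor (cyclotomic p (ZMod 2))
    (not_isUnit_of_natDegree_pos _ (by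
      rw [natDegree_cyclotomic]; exact Nat.totient_pos.2 hp.pos))
  obtain ⟨h, hh⟩ := hd.trans (cyclotomic.dvd_X_pow_sub_one p (ZMod 2))
  refine ⟨q, hm, hi, fun h0 => ?_, h, hh.symm, ?_⟩
  · have := eval_dvd (x := 1) hd
    rw [h0, eval_one_cyclotomic_prime, zero_dvd_iff, h2] at this
    exact one_ne_zero this
  · refine Separable.isCoprime ?_
    rw [← hh, X_pow_sub_one_separable_iff, h2]
    exact one_ne_zero

/-! ### Projectivity and the involution. -/

/-- `β` truncates to `X`: exactly one of `h` and `t⁻¹ * h` lies in `X`, and a `t`-fixed element has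
equal coefficients at both. -/
theorem MonoidAlgebra.exists_function_of_single_mul_eq {R H : Type*} [Ring R] [Group H] (t : H)
    (X : Set H) (hX : ∀ h, h ∈ X ↔ t⁻¹ * h ∉ X) :
    ∃ β : MonoidAlgebra R H → MonoidAlgebra R H, β 0 = 0 ∧
      ∀ a, MonoidAlgebra.single t 1 * a = a → (1 + MonoidAlgebra.single t 1) * β a = a := by
  classical
  refine ⟨fun a => .ofCoeff (a.coeff.filter (· ∈ X)), ?_, fun a ha => ?_⟩
  · ext h
    exact congrArg (· h) (Finsupp.filter_zero (M := R) (· ∈ X))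
  · ext h
    have h1 : a.coeff (t⁻¹ * h) = a.coeff h := by
      conv_rhs => rw [← ha]
      simp
    rw [add_mul, one_mul]
    by_cases hh : h ∈ X
    · simp [hh, (hX h).1 hh]
    · have : t⁻¹ * h ∈ X := by
        by_contra h2
        exact hh ((hX h).2 h2)
      simp [hh, this, h1]

/-- A vector of a projective module that is fixed by `t` is in the image of `1 + t`, in
characteristic two, if the group splits into two halves exchanged by `t`. -/
theorem exists_add_smul_eq_of_projective {R H M : Type*} [Ring R] [Group H] [AddCommGroup M]
    [Module (MonoidAlgebra R H) M] [Module.Projective (MonoidAlgebra R H) M] (t : H)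
    (X : Set H) (hX : ∀ h, h ∈ X ↔ t⁻¹ * h ∉ X) (v : M)
    (hv : (MonoidAlgebra.single t 1 : MonoidAlgebra R H) • v = v) :
    ∃ u : M, u + (MonoidAlgebra.single t 1 : MonoidAlgebra R H) • u = v := by
  obtain ⟨β, hβ0, hβ⟩ := MonoidAlgebra.exists_function_of_single_mul_eq (R := R) t X hX
  obtain ⟨s, hs⟩ := Module.projective_def'.1 ‹Module.Projective (MonoidAlgebra R H) M›
  -- The equation is solved coordinatewise in a free module containing `M` as a summand, then
  -- projected back to `M`.
  let b : M →₀ MonoidAlgebra R H := (s v).mapRange β hβ0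
  have hb : (1 + MonoidAlgebra.single t 1 : MonoidAlgebra R H) • b = s v := by
    ext1 m
    rw [Finsupp.smul_apply, Finsupp.mapRange_apply, smul_eq_mul, hβ]
    rw [← smul_eq_mul, ← Finsupp.smul_apply, ← map_smul, hv]
  refine ⟨Finsupp.linearCombination _ id b, ?_⟩
  have h1 := congrArg (Finsupp.linearCombination (MonoidAlgebra R H) (id : M → M)) hb
  rw [map_smul, add_smul, one_smul] at h1
  rw [h1]
  exact LinearMap.congr_fun hs v

theorem exists_add_permRep_eq_of_isProjectiveCode {n p : ℕ} (hp_odd : Odd p)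
    (C : Submodule (ZMod 2) (Fin n → ZMod 2)) (g : codeAut C) (hg : orderOf g = 2 * p)
    (hC : IsProjectiveCode C g) (v : Fin n → ZMod 2) (hvC : v ∈ C)
    (hv : permRep n ((g : Equiv.Perm (Fin n)) ^ p) v = v) :
    ∃ u ∈ C, u + permRep n ((g : Equiv.Perm (Fin n)) ^ p) u = v := by
  let t : Subgroup.zpowers g := ⟨g ^ p, p, by simp⟩
  -- The subgroup of index two, exchanged with its complement by `t` since `t ^ p = t ≠ 1`.
  let X : Set (Subgroup.zpowers g) := {h | h ^ p = 1}
  have hord : t ^ p = t ∧ t ≠ 1 ∧ ∀ h : Subgroup.zpowers g, h ^ p = 1 ∨ h ^ p = t := by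
    have hgp : g ^ p ≠ 1 := by
      intro h
      have := Nat.le_of_dvd hp_odd.pos (orderOf_dvd_of_pow_eq_one h)
      have := hp_odd.pos
      omega
    have hg2 : (g ^ p) ^ 2 = 1 := by rw [← pow_mul, mul_comm, ← hg, pow_orderOf_eq_one]
    refine ⟨Subtype.ext ?_, fun h => hgp (congrArg Subtype.val h), ?_⟩
    · change (g ^ p) ^ p = g ^ p
      obtain ⟨m, hm⟩ := hp_odd
      conv_lhs => rw [hm, pow_succ, pow_mul]
      rw [← hm, hg2, one_pow, one_mul]
    · rintro ⟨h, k, rfl⟩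
      have h1 : (g ^ k) ^ p = (g ^ p) ^ k := by
        rw [← zpow_natCast, ← zpow_mul, mul_comm, zpow_mul, zpow_natCast]
      have hg2' : (g ^ p) ^ (2 : ℤ) = 1 := by exact_mod_cast hg2
      rcases Int.even_or_odd' k with ⟨m, rfl | rfl⟩
      · left
        refine Subtype.ext ?_
        change (g ^ _) ^ p = 1
        rw [h1, zpow_mul, hg2', one_zpow]
      · right
        refine Subtype.ext ?_
        change (g ^ _) ^ p = g ^ p
        rw [h1, zpow_add, zpow_mul, hg2', one_zpow, one_mul, zpow_one]
  obtain ⟨htp, ht1, hpow⟩ := hord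
  have hX : ∀ h, h ∈ X ↔ t⁻¹ * h ∉ X := by
    intro h
    change h ^ p = 1 ↔ ¬ (t⁻¹ * h) ^ p = 1
    have hcomm : Commute t⁻¹ h := by
      obtain ⟨k, hk⟩ := h.2
      refine Commute.inv_left (Subtype.ext ?_)
      change g ^ p * h.1 = h.1 * g ^ p
      rw [← hk]
      exact (Commute.pow_left (Commute.zpow_right (Commute.refl g) k) p)
    rw [hcomm.mul_pow, inv_pow, htp]
    rcases hpow h with h1 | h1 <;> rw [h1]
    · simpa using ht1
    · simpa using ht1
  have : Module.Projective (MonoidAlgebra (ZMod 2) (Subgroup.zpowers g))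
    (cyclicCodeRep C g).asModule := hC
  have hsm (w : C) : (MonoidAlgebra.single t 1 : MonoidAlgebra (ZMod 2) (Subgroup.zpowers g)) •
      ((cyclicCodeRep C g).asModuleEquiv.symm w) =
      (cyclicCodeRep C g).asModuleEquiv.symm (cyclicCodeRep C g t w) :=
    ((cyclicCodeRep C g).asModuleEquiv_symm_map_rho t w).symm
  obtain ⟨u, hu⟩ := exists_add_smul_eq_of_projective (R := ZMod 2) t X hX
    ((cyclicCodeRep C g).asModuleEquiv.symm ⟨v, hvC⟩) (by
      rw [hsm]
      exact congrArg _ (Subtype.ext hv))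
  obtain ⟨w, rfl⟩ := (cyclicCodeRep C g).asModuleEquiv.symm.surjective u
  rw [hsm, ← map_add] at hu
  exact ⟨w.1, w.2, congrArg Subtype.val ((cyclicCodeRep C g).asModuleEquiv.symm.injective hu)⟩

/-! ### Self-duality and the decomposition by `q(σ)`. -/

/-- A self-dual subspace compatible with an orthogonal decomposition `U ⊕ W` meets `U` in a
subspace of half the dimension. -/
theorem two_mul_finrank_inf_of_orthogonal {K V : Type*} [Field K] [AddCommGroup V] [Module K V]
    [FiniteDimensional K V] (B : LinearMap.BilinForm K V) (hB : B.Nondegenerate)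
    (hB' : B.IsRefl)
    (C U W : Submodule K V) (hC : B.orthogonal C = C) (hU : B.orthogonal U = W)
    (hCUW : C ≤ (C ⊓ U) ⊔ (C ⊓ W)) (hUW : Disjoint U W) :
    2 * Module.finrank K ↥(C ⊓ U) = Module.finrank K U := by
  have h1 := Submodule.finrank_sup_add_finrank_inf_eq (C ⊓ U) (C ⊓ W)
  have h2 : (C ⊓ U) ⊔ (C ⊓ W) = C := le_antisymm (sup_le inf_le_left inf_le_left) hCUW
  have h3 : (C ⊓ U) ⊓ (C ⊓ W) = ⊥ :=
    (hUW.mono inf_le_right inf_le_right).eq_bot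
  rw [h2, h3, finrank_bot, add_zero] at h1
  have hCn := LinearMap.BilinForm.finrank_orthogonal hB C
  have hUn := LinearMap.BilinForm.finrank_orthogonal hB U
  rw [hC] at hCn
  rw [hU] at hUn
  -- Used for `(U, W)` and `(W, U)`, this bounds `dim (C ⊓ U) - dim (C ⊓ W)` from both sides; the
  -- sum of these dimensions is `dim C`.
  have key (X Y : Submodule K V) (hX : Y ≤ B.orthogonal X) :
      C ⊔ Y ≤ B.orthogonal (C ⊓ X) := by
    refine sup_le ?_ ?_
    · conv_lhs => rw [← hC]
      exact LinearMap.BilinForm.orthogonal_le inf_le_left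
    · exact hX.trans (LinearMap.BilinForm.orthogonal_le inf_le_right)
  have hWU : U ≤ B.orthogonal W := by
    rw [← hU]
    exact LinearMap.BilinForm.le_orthogonal_orthogonal hB'
  have h4 := Submodule.finrank_mono (key U W hU.ge)
  have h5 := Submodule.finrank_mono (key W U hWU)
  rw [LinearMap.BilinForm.finrank_orthogonal hB] at h4 h5
  have h6 := Submodule.finrank_sup_add_finrank_inf_eq C W
  have h7 := Submodule.finrank_sup_add_finrank_inf_eq C U
  have := Submodule.finrank_le C
  have := Submodule.finrank_le U
  have := Submodule.finrank_le (C ⊓ U)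
  have := Submodule.finrank_le (C ⊓ W)
  lia

theorem isRefl_dotProductBilin {K ι : Type*} [Field K] [Fintype ι] :
    LinearMap.BilinForm.IsRefl (dotProductBilin K K : LinearMap.BilinForm K (ι → K)) := by
  intro u v h
  change v ⬝ᵥ u = 0
  rw [dotProduct_comm]
  exact h

theorem nondegenerate_dotProductBilin {K ι : Type*} [Field K] [Fintype ι] :
    LinearMap.BilinForm.Nondegenerate (dotProductBilin K K : LinearMap.BilinForm K (ι → K)) := by
  classical
  have h : LinearMap.IsRefl (dotProductBilin K K : LinearMap.BilinForm K (ι → K)) :=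
    isRefl_dotProductBilin
  refine h.nondegenerate_iff_separatingLeft.2 ?_
  intro u hu
  exact dotProduct_eq_zero u hu

open Polynomial in
theorem aeval_apply_mem_of_mapsTo {K V : Type*} [Field K] [AddCommGroup V] [Module K V]
    {C : Submodule K V} {S : Module.End K V} (hS : ∀ c ∈ C, S c ∈ C) (f : K[X]) {c : V}
    (hc : c ∈ C) : aeval S f c ∈ C := by
  rw [aeval_eq_sum_range, LinearMap.sum_apply]
  exact sum_mem fun j _ => C.smul_mem _ (Module.End.pow_apply_mem_of_forall_mem j hS c hc)

-- Permutations preserve the dot product, so the adjoint of `σ` is `σ⁻¹`.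
open Polynomial in
theorem dotProduct_aeval_funLeft {K ι : Type*} [Field K] [Fintype ι] (σ : Equiv.Perm ι)
    (f : K[X]) (u v : ι → K) : u ⬝ᵥ aeval (LinearMap.funLeft K K σ) f v =
      aeval (LinearMap.funLeft K K ⇑σ⁻¹) f u ⬝ᵥ v := by
  have h (j : ℕ) (u : ι → K) : u ⬝ᵥ ((LinearMap.funLeft K K σ) ^ j) v =
      ((LinearMap.funLeft K K ⇑σ⁻¹) ^ j) u ⬝ᵥ v := by
    induction j generalizing u with
    | zero => rfl
    | succ j ih =>
      rw [pow_succ', pow_succ, Module.End.mul_apply, Module.End.mul_apply, ← ih]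
      refine (Fintype.sum_equiv σ _ _ fun i => ?_)
      simp [LinearMap.funLeft_apply]
  rw [aeval_eq_sum_range, aeval_eq_sum_range, LinearMap.sum_apply, LinearMap.sum_apply,
    dotProduct_sum, sum_dotProduct]
  refine Finset.sum_congr rfl fun j _ => ?_
  rw [LinearMap.smul_apply, LinearMap.smul_apply, dotProduct_smul, smul_dotProduct, h]

open Polynomial in
/-- The kernel and the range of `q(σ)` are orthogonal complements of each other, because the
adjoint of `q(σ)` is one of its powers. -/
theorem orthogonal_ker_aeval_funLeft {n p k : ℕ} (hk : p ∣ 2 ^ k + 1)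
    (σ : Equiv.Perm (Fin n)) (hσ : σ ^ p = 1) (q : (ZMod 2)[X]) :
    LinearMap.BilinForm.orthogonal (dotProductBilin (ZMod 2) (ZMod 2))
      (LinearMap.ker (aeval (LinearMap.funLeft (ZMod 2) (ZMod 2) σ) q)) =
    LinearMap.range (aeval (LinearMap.funLeft (ZMod 2) (ZMod 2) σ) q) := by
  set S := LinearMap.funLeft (ZMod 2) (ZMod 2) σ
  have hpow (j : ℕ) : S ^ j = LinearMap.funLeft (ZMod 2) (ZMod 2) ⇑(σ ^ j) := by
    induction j with
    | zero => rfl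
    | succ j ih => rw [pow_succ', ih, pow_succ]; rfl
  have hinv : σ⁻¹ = σ ^ 2 ^ k := by
    obtain ⟨m, hm⟩ := hk
    rw [inv_eq_iff_mul_eq_one, ← pow_succ', hm, pow_mul, hσ, one_pow]
  symm
  apply Submodule.eq_of_le_of_finrank_eq
  · rintro _ ⟨v, rfl⟩ u hu
    change u ⬝ᵥ _ = 0
    rw [dotProduct_aeval_funLeft, hinv, ← hpow, aeval_pow_two_pow]
    -- The exponent `2 ^ k` is positive, so one factor `q(σ)` is left to kill `u`.
    obtain ⟨m, hm⟩ := Nat.exists_eq_succ_of_ne_zero (pow_ne_zero k (two_ne_zero (α := ℕ)))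
    rw [hm, pow_succ, Module.End.mul_apply, LinearMap.mem_ker.1 hu, map_zero, zero_dotProduct]
  · rw [LinearMap.BilinForm.finrank_orthogonal nondegenerate_dotProductBilin]
    have := LinearMap.finrank_range_add_finrank_ker (aeval S q)
    lia

theorem natDegree_dvd_finrank_of_invariant {K V : Type*} [Field K] [AddCommGroup V] [Module K V]
    {q : Polynomial K} (hq : Irreducible q) {S : Module.End K V} {N : Submodule K V}
    (hSN : ∀ c ∈ N, S c ∈ N) (hN : ∀ c ∈ N, Polynomial.aeval S q c = 0) :
    q.natDegree ∣ Module.finrank K N := by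
  refine natDegree_dvd_finrank_of_aeval_eq_zero hq (S.restrict hSN)
    (LinearMap.ext fun c => Subtype.ext ?_)
  refine Eq.trans ?_ (hN c.1 c.2)
  rw [Polynomial.aeval_eq_sum_range, Polynomial.aeval_eq_sum_range, LinearMap.sum_apply,
    LinearMap.sum_apply, Submodule.coe_sum]
  refine Finset.sum_congr rfl fun j _ => ?_
  rw [Module.End.pow_restrict]
  rfl

theorem permRep_inv {n : ℕ} (σ : Equiv.Perm (Fin n)) :
    permRep n σ⁻¹ = LinearMap.funLeft (ZMod 2) (ZMod 2) σ := by
  refine LinearMap.ext fun c => funext fun i => ?_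
  change c ((σ⁻¹)⁻¹ i) = c (σ i)
  rw [inv_inv]

/-! ### The contradiction modulo four. -/

theorem mainTheorem9 (n p : ℕ) (hp : p.Prime) (hp_odd : Odd p)
    (C : Submodule (ZMod 2) (Fin n → ZMod 2)) (hC : IsSelfDualCode C)
    (g : codeAut C) (hg : orderOf g = 2 * p)
    (hfree : ∀ i : Fin n, ((g : Equiv.Perm (Fin n)) ^ p) i ≠ i)
    (hn : n ≡ 0 [MOD 4]) (hs : Even (sExp p))
    (hw : Odd ((g : Equiv.Perm (Fin n)).cycleType.count 2)) :
    ¬ IsProjectiveCode C g := by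
  intro hproj
  set g' : Equiv.Perm (Fin n) := (g : Equiv.Perm (Fin n)) with hg'
  have hord : orderOf g' = 2 * p := by rw [hg', Subgroup.orderOf_coe, hg]
  have hσ : orderOf (g' ^ 2) = p := by
    rw [orderOf_pow, hord, Nat.gcd_eq_right (dvd_mul_right 2 p)]
    exact Nat.mul_div_cancel_left p two_pos
  obtain ⟨k, hk⟩ := exists_dvd_two_pow_add_one_of_even_sExp hp hp_odd hs
  obtain ⟨q, hqm, hqi, hq1, h, hqh, a, b, hab⟩ := exists_irreducible_dvd_cyclotomic hp hp_odd
  have hcard := card_eq_of_free_involution hp g' hσ hfree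
  have hker := finrank_ker_aeval_funLeft hqm hp ⟨h, hqh.symm⟩ hq1 (g' ^ 2) hσ
  have horth := orthogonal_ker_aeval_funLeft hk (g' ^ 2) (by rw [← hσ, pow_orderOf_eq_one]) q
  set r := (g' ^ 2).cycleFactorsFinset.card
  set S : Module.End (ZMod 2) (Fin n → ZMod 2) :=
    LinearMap.funLeft (ZMod 2) (ZMod 2) ⇑(g' ^ 2) with hS
  have hmem (x : codeAut C) (c : Fin n → ZMod 2) (hc : c ∈ C) : permRep n x c ∈ C :=
    (codeRep C x ⟨c, hc⟩).2
  have hSC : ∀ c ∈ C, S c ∈ C := by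
    intro c hc
    rw [hS, ← permRep_inv]
    exact hmem (g ^ 2)⁻¹ c hc
  have hSp : Polynomial.aeval S (Polynomial.X ^ p - 1 : Polynomial (ZMod 2)) = 0 := by
    have hpow (j : ℕ) : S ^ j = LinearMap.funLeft (ZMod 2) (ZMod 2) ⇑((g' ^ 2) ^ j) := by
      induction j with
      | zero => rfl
      | succ j ih => rw [pow_succ', ih, pow_succ]; rfl
    rw [map_sub, map_pow, Polynomial.aeval_X, map_one, hpow, ← hσ, pow_orderOf_eq_one]
    exact sub_self _
  have hTh (v) : Polynomial.aeval S q (Polynomial.aeval S h v) = 0 := by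
    rw [← Module.End.mul_apply, ← map_mul, hqh, hSp, LinearMap.zero_apply]
  -- Bézout: the first summand lies in `W`, the second in `U`.
  have hdec (v) : Polynomial.aeval S q (Polynomial.aeval S a v) +
      Polynomial.aeval S h (Polynomial.aeval S b v) = v := by
    rw [← Module.End.mul_apply, ← Module.End.mul_apply, ← map_mul, ← map_mul,
      ← LinearMap.add_apply, ← map_add, mul_comm q, mul_comm h, hab, map_one]
    rfl
  have hcomm (f f' : Polynomial (ZMod 2)) (v) :
      Polynomial.aeval S f (Polynomial.aeval S f' v) =
        Polynomial.aeval S f' (Polynomial.aeval S f v) := by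
    rw [← Module.End.mul_apply, ← Module.End.mul_apply, ← map_mul, mul_comm, map_mul]
  set U := LinearMap.ker (Polynomial.aeval S q)
  set W := LinearMap.range (Polynomial.aeval S q)
  have hhalf : 2 * Module.finrank (ZMod 2) ↥(C ⊓ U) = Module.finrank (ZMod 2) U := by
    refine two_mul_finrank_inf_of_orthogonal _ nondegenerate_dotProductBilin
      isRefl_dotProductBilin C U W hC.symm horth ?_ ?_
    · intro c hc
      rw [← hdec c, add_comm]
      refine Submodule.add_mem_sup ⟨?_, ?_⟩ ⟨?_, ?_⟩
      · exact aeval_apply_mem_of_mapsTo hSC _ (aeval_apply_mem_of_mapsTo hSC _ hc)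
      · exact hTh _
      · exact aeval_apply_mem_of_mapsTo hSC _ (aeval_apply_mem_of_mapsTo hSC _ hc)
      · exact ⟨_, rfl⟩
    · rw [Submodule.disjoint_def]
      rintro _ hu ⟨v, rfl⟩
      rw [← hdec (Polynomial.aeval S q v), hcomm q a, LinearMap.mem_ker.1 hu, map_zero, zero_add,
        hcomm b q, hcomm h q, hTh]
  let τ : Module.End (ZMod 2) (Fin n → ZMod 2) := permRep n (g' ^ p)
  have hτC : ∀ c ∈ C, τ c ∈ C := hmem (g ^ p)
  have hτ2 (v) : τ (τ v) = v := by
    change (permRep n (g' ^ p) * permRep n (g' ^ p)) v = v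
    rw [← map_mul, ← pow_add, ← two_mul, ← hord, pow_orderOf_eq_one, map_one]
    rfl
  have hτS : Commute τ S := by
    rw [hS, ← permRep_inv]
    change permRep n _ * permRep n _ = permRep n _ * permRep n _
    rw [← map_mul, ← map_mul, ((Commute.refl g').pow_pow p 2).inv_right.eq]
  have hτf (f : Polynomial (ZMod 2)) (v) :
      τ (Polynomial.aeval S f v) = Polynomial.aeval S f (τ v) := by
    have h1 : Commute τ (Polynomial.aeval S f) := by
      rw [Polynomial.aeval_eq_sum_range]
      exact Commute.sum_right _ _ _ fun j _ => (hτS.pow_right j).smul_right _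
    exact LinearMap.congr_fun h1.eq v
  have hCU : ∀ c ∈ C ⊓ U, (1 + τ) c ∈ C ⊓ U := by
    rintro c ⟨hc, hu⟩
    refine ⟨C.add_mem hc (hτC c hc), U.add_mem hu ?_⟩
    change Polynomial.aeval S q (τ c) = 0
    rw [← hτf, LinearMap.mem_ker.1 hu, map_zero]
  let D : Module.End (ZMod 2) ↥(C ⊓ U) := (1 + τ).restrict hCU
  have hadd (v : Fin n → ZMod 2) : v + v = 0 := funext fun i => CharTwo.add_self_eq_zero (v i)
  have hexact : LinearMap.range D = LinearMap.ker D := by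
    ext ⟨v, hvC, hvU⟩
    constructor
    · rintro ⟨⟨u, hu⟩, huv⟩
      have huv' : u + τ u = v := congrArg Subtype.val huv
      refine Subtype.ext ?_
      change v + τ v = 0
      rw [← huv', map_add, hτ2, add_comm (τ u) u, hadd]
    · intro hv
      have hv' : v + τ v = 0 := congrArg Subtype.val hv
      obtain ⟨u, huC, hu⟩ := exists_add_permRep_eq_of_isProjectiveCode hp_odd C g hg hproj v hvC
        (add_left_cancel (hv'.trans (hadd v).symm))
      -- The preimage `u` lies only in `C`; its `U`-component works, as the projection commutes with
      -- `τ` and fixes `v`.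
      refine ⟨⟨Polynomial.aeval S h (Polynomial.aeval S b u), aeval_apply_mem_of_mapsTo hSC _
        (aeval_apply_mem_of_mapsTo hSC _ huC), hTh _⟩, Subtype.ext ?_⟩
      change Polynomial.aeval S h (Polynomial.aeval S b u) +
        τ (Polynomial.aeval S h (Polynomial.aeval S b u)) = v
      change u + τ u = v at hu
      rw [hτf, hτf, ← map_add, ← map_add, hu]
      conv_rhs => rw [← hdec v, hcomm q a, LinearMap.mem_ker.1 hvU, map_zero, zero_add]
  have hD := LinearMap.finrank_range_add_finrank_ker D
  rw [hexact] at hD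
  have hSU : ∀ c ∈ C ⊓ U, S c ∈ C ⊓ U := by
    rintro c ⟨hc, hu⟩
    refine ⟨hSC c hc, ?_⟩
    have h1 := hcomm q Polynomial.X c
    rw [Polynomial.aeval_X, LinearMap.mem_ker.1 hu, map_zero] at h1
    exact h1
  have hdvd : q.natDegree ∣ Module.finrank (ZMod 2) (LinearMap.ker D) := by
    rw [← Submodule.finrank_map_subtype_eq]
    refine natDegree_dvd_finrank_of_invariant hqi (S := S) ?_ ?_
    · rintro _ ⟨c, hc, rfl⟩
      refine ⟨⟨S c.1, hSU _ c.2⟩, Subtype.ext ?_, rfl⟩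
      have hc' : c.1 + τ c.1 = 0 := congrArg Subtype.val hc
      change S c.1 + τ (S c.1) = 0
      rw [← Module.End.mul_apply, hτS.eq, Module.End.mul_apply, ← map_add, hc', map_zero]
    · rintro _ ⟨c, -, rfl⟩
      exact c.2.2
  obtain ⟨m, hm⟩ := hdvd
  -- One factor two comes from self-duality, the other from `dim (C ⊓ U) = 2 dim ker D`.
  have hr : r = 4 * m := by
    refine Nat.eq_of_mul_eq_mul_left hqi.natDegree_pos ?_
    rw [← hker, ← hhalf, ← hD, hm]
    ring
  rw [Fintype.card_fin, hr] at hcard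
  obtain ⟨w, hw⟩ := hw
  rw [hw] at hcard
  have h4 : 4 ∣ n := (Nat.modEq_zero_iff_dvd).1 hn
  rw [hcard, mul_left_comm] at h4
  have := (Nat.dvd_add_right (dvd_mul_right 4 (p * m))).1 h4
  lia
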